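/- For an integer $k\ge 1$ let $(U_n(k))_{n\ge 0}$ be the strictly increasing sequence of integers given by $$U_0(k)=0,\quad U_1(k)=1,\quad U_{n+2}(k)=(4k+2)\,U_{n+1}(k)-U_n(k)\qquad(n\ge 0).$$ For $n\ge 1$ let $\mathcal D_k(n)$ be the smallest integer $m\ge 1$ such that $U_0(k),\ldots,U_{n-1}(k)$ are pairwise incongruent modulo $m$, and let $\mathcal D_k=\{\mathcal D_k(n): n\ge 1\}$ be the set of values of this discriminator. Let $p$ denote primes, and let $$\mathcal A_k=\{m\ge 1 \text{ odd}:\ p\mid m\Rightarrow p\mid k\},\qquad \mathcal B_k=\{m\ge 1\text{ even}:\ p\mid m\Rightarrow p\mid k(k+1)\},$$ with the following additional requirements: if $k\equiv 6\pmod 9$, the elements $m$ of $\mathcal A_k$ must also satisfy $9\nmid m$; if $k\equiv 2\pmod 9$ or $k\equiv 6\pmod 9$, the elements $m$ of $\mathcal B_k$ must also satisfy $9\nmid m$. Then for every integer $k>1$ there is a finite set $\mathcal F_k$ of positive integers such that $$\mathcal D_k=\mathcal A_k\cup\mathcal B_k\cup\mathcal F_k .$$ Moreover, for $k=2$ one can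 take $\mathcal F_2=\emptyset$, i.e. $\mathcal D_2=\mathcal A_2\cup\mathcal B_2$. -/

import Mathlib

/-- The Lucas sequence `U_n(k)`: `U_0 = 0`, `U_1 = 1`, `U_{n+2} = (4k+2) U_{n+1} - U_n`. -/
def lucasU (k : ℕ) : ℕ → ℤ
  | 0 => 0
  | 1 => 1
  | n + 2 => (4 * (k : ℤ) + 2) * lucasU k (n + 1) - lucasU k n

/-- The modulus `m` discriminates the first `n` terms of `a`: `m ≥ 1` and
`a 0, …, a (n-1)` are pairwise incongruent modulo `m`. -/
def Discriminates (a : ℕ → ℤ) (n m : ℕ) : Prop :=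
  1 ≤ m ∧ ∀ i < n, ∀ j < n, i ≠ j → ¬ a i ≡ a j [ZMOD (m : ℤ)]

/-- The discriminator: the smallest `m ≥ 1` that discriminates the first `n` terms of `a`. -/
noncomputable def discriminator (a : ℕ → ℤ) (n : ℕ) : ℕ :=
  sInf {m : ℕ | Discriminates a n m}

/-- The value set `{D_a(n) : n ≥ 1}` of the discriminator. -/
def discriminatorValues (a : ℕ → ℤ) : Set ℕ :=
  {m : ℕ | ∃ n : ℕ, 1 ≤ n ∧ discriminator a n = m}

/-- Positive odd integers composed of prime factors of `k`, and not divisible by `9`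
when `k ≡ 6 (mod 9)`. -/
def setA (k : ℕ) : Set ℕ :=
  {m : ℕ | 0 < m ∧ Odd m ∧ (∀ p : ℕ, p.Prime → p ∣ m → p ∣ k) ∧
    (k ≡ 6 [MOD 9] → ¬ 9 ∣ m)}

/-- Positive even integers composed of prime factors of `k (k + 1)`, and not divisible by `9`
when `k ≡ 2` or `k ≡ 6 (mod 9)`. -/
def setB (k : ℕ) : Set ℕ :=
  {m : ℕ | 0 < m ∧ Even m ∧ (∀ p : ℕ, p.Prime → p ∣ m → p ∣ k * (k + 1)) ∧
    ((k ≡ 2 [MOD 9] ∨ k ≡ 6 [MOD 9]) → ¬ 9 ∣ m)}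

/-- The sequence is strictly increasing when `k ≥ 1`. -/
theorem lucasU_strictMono (k : ℕ) (hk : 1 ≤ k) : StrictMono (lucasU k) := by
  have key : ∀ n, 0 ≤ lucasU k n ∧ lucasU k n < lucasU k (n + 1) := by
    intro n
    induction n with
    | zero => simp [lucasU]
    | succ n ih =>
      obtain ⟨h0, h1⟩ := ih
      refine ⟨by linarith, ?_⟩
      have hk' : (1 : ℤ) ≤ k := by exact_mod_cast hk
      show lucasU k (n + 1) < (4 * (k : ℤ) + 2) * lucasU k (n + 1) - lucasU k n
      nlinarith
  exact strictMono_nat_of_lt_succ fun n => (key n).2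

/-- For a strictly increasing sequence the set in the definition of the discriminator is
nonempty, so the discriminator is a genuine minimum. -/
theorem discriminates_discriminator (a : ℕ → ℤ) (ha : StrictMono a) (n : ℕ) :
    Discriminates a n (discriminator a n) := by
  have hne : {m : ℕ | Discriminates a n m}.Nonempty := by
    refine ⟨(a n - a 0).toNat + 1, by omega, ?_⟩
    intro i hi j hj hij h
    have h0i := ha.monotone (Nat.zero_le i)
    have h0j := ha.monotone (Nat.zero_le j)
    have hin := ha hi
    have hjn := ha hj
    have hd := h.dvd
    have hz : a j - a i = 0 := by
      refine Int.eq_zero_of_abs_lt_dvd hd ?_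
      rw [abs_lt]
      push_cast
      constructor <;> omega
    exact hij (ha.injective (by omega))
  exact Nat.sInf_mem hne

/-! Two facts decide everything. If m lies in A ∪ B, then m ∣ U_{j+d} − U_j forces m ∣ d, so m
discriminates its first m terms and is the discriminator of n = m (`dvd_of_dvd_lucasU_sub`). Any
other m discriminates at most 2m/3 terms (`Discriminates.three_mul_le`). Hence D(n) ∈ A ∪ B whenever
A ∪ B meets [n, 3n/2).

For the first fact, U_{j+d} − U_j factors with a cofactor that Cassini's identity makes a unit mod m
(up to a harmless 2), and the law of repetition turns m ∣ U_d into m ∣ d. For the second, m has a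
prime factor of rank at most (p+1)/2, or is a multiple of 9 with 9 ∣ U_3, or is odd with a factor
built from primes of k + 1, which creates an early collision.

For k > 2 the numbers 2^a p^j, for a suitable odd prime p, eventually meet every [n, 3n/2); for k =
2 the numbers 2^a and 3·2^a do so for all n. -/

/-! ### Identities for Lucas sequences with arbitrary parameter -/

/-- The Lucas sequence `S_0 = 0`, `S_1 = 1`, `S_{n+2} = x S_{n+1} - S_n` with integer
parameter `x`. -/
def lucasS (x : ℤ) : ℕ → ℤ
  | 0 => 0
  | 1 => 1
  | n + 2 => x * lucasS x (n + 1) - lucasS x n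

/-- The companion sequence of `lucasS`. -/
def lucasV (x : ℤ) (n : ℕ) : ℤ := 2 * lucasS x (n + 1) - x * lucasS x n

@[simp] theorem lucasS_zero (x : ℤ) : lucasS x 0 = 0 := rfl

@[simp] theorem lucasS_one (x : ℤ) : lucasS x 1 = 1 := rfl

theorem lucasS_add_two (x : ℤ) (n : ℕ) :
    lucasS x (n + 2) = x * lucasS x (n + 1) - lucasS x n := rfl

theorem lucasS_two (x : ℤ) : lucasS x 2 = x := by
  simp [lucasS_add_two x 0]

theorem lucasS_three (x : ℤ) : lucasS x 3 = x ^ 2 - 1 := by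
  rw [lucasS_add_two x 1, lucasS_two, lucasS_one]; ring

theorem lucasV_three (x : ℤ) : lucasV x 3 = x ^ 3 - 3 * x := by
  rw [lucasV, lucasS_add_two x 2, lucasS_three, lucasS_two]; ring

theorem lucasU_eq_lucasS (k n : ℕ) : lucasU k n = lucasS (4 * (k : ℤ) + 2) n := by
  induction n using Nat.twoStepInduction with
  | zero => rfl
  | one => rfl
  | more n h1 h2 => rw [lucasU, lucasS_add_two, h1, h2]

theorem lucasS_cassini (x : ℤ) (n : ℕ) :
    lucasS x (n + 1) ^ 2 - x * lucasS x (n + 1) * lucasS x n + lucasS x n ^ 2 = 1 := by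
  induction n with
  | zero => simp
  | succ n ih => rw [lucasS_add_two]; linear_combination ih

theorem lucasS_add_succ (x : ℤ) (a n : ℕ) :
    lucasS x (a + n + 1) = lucasS x (a + 1) * lucasS x (n + 1) - lucasS x a * lucasS x n := by
  induction n using Nat.twoStepInduction with
  | zero => simp
  | one =>
    rw [show a + 1 + 1 = a + 2 by ring, lucasS_add_two, lucasS_two]; simp; ring
  | more n h1 h2 =>
    rw [show a + (n + 2) + 1 = (a + n + 1) + 2 by ring, lucasS_add_two,
      show a + n + 1 + 1 = a + (n + 1) + 1 by ring, h2, h1, show n + 2 + 1 = n + 1 + 2 by ring,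
      lucasS_add_two x (n + 1), lucasS_add_two x n]
    ring

theorem lucasS_add (x : ℤ) (a n : ℕ) :
    lucasS x (a + n) = lucasS x a * lucasS x (n + 1) + lucasS x (a + 1) * lucasS x n
      - x * lucasS x a * lucasS x n := by
  cases n with
  | zero => simp
  | succ n =>
    rw [show a + (n + 1) = a + n + 1 by ring, lucasS_add_succ, lucasS_add_two]; ring

theorem lucasS_add_two_mul_sub (x : ℤ) (j d : ℕ) :
    lucasS x (j + 2 * d) - lucasS x j = lucasS x d * lucasV x (j + d) := by
  rw [show j + 2 * d = (j + d) + d by ring, lucasV, lucasS_add x (j + d) d,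
    lucasS_add_succ x j d, lucasS_add x j d]
  linear_combination lucasS x j * lucasS_cassini x d

theorem lucasS_two_mul (x : ℤ) (d : ℕ) : lucasS x (2 * d) = lucasS x d * lucasV x d := by
  simpa using lucasS_add_two_mul_sub x 0 d

/-- At odd distance there is no middle index; S_{d+1} + S_d and S_{j+d+1} − S_{j+d} stand in for
terms at half-integer indices. -/
theorem lucasS_add_two_mul_add_one_sub (x : ℤ) (j d : ℕ) :
    lucasS x (j + (2 * d + 1)) - lucasS x j =
      (lucasS x (d + 1) + lucasS x d) * (lucasS x (j + d + 1) - lucasS x (j + d)) := by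
  rw [show j + (2 * d + 1) = (j + d) + d + 1 by ring, lucasS_add_succ x (j + d) d,
    lucasS_add_succ x j d, lucasS_add x j d]
  linear_combination lucasS x j * lucasS_cassini x d

theorem lucasS_two_mul_add_one (x : ℤ) (d : ℕ) :
    lucasS x (2 * d + 1) =
      (lucasS x (d + 1) + lucasS x d) * (lucasS x (d + 1) - lucasS x d) := by
  simpa using lucasS_add_two_mul_add_one_sub x 0 d

theorem lucasS_add_two_mul (x : ℤ) (a n : ℕ) :
    lucasS x (a + 2 * n) = lucasV x n * lucasS x (a + n) - lucasS x a := by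
  rw [show a + 2 * n = (a + n) + n by ring, lucasV, lucasS_add x (a + n) n,
    lucasS_add_succ x a n, lucasS_add x a n]
  linear_combination (-lucasS x a) * lucasS_cassini x n

/-- Raising the characteristic root to the n-th power changes the parameter x to V_n. Arguments by
descent on the index therefore need an arbitrary parameter. -/
theorem lucasS_mul (x : ℤ) (m n : ℕ) :
    lucasS x (m * n) = lucasS x n * lucasS (lucasV x n) m := by
  induction m using Nat.twoStepInduction with
  | zero => simp
  | one => simp
  | more m h1 h2 =>
    rw [show (m + 2) * n = m * n + 2 * n by ring, lucasS_add_two_mul,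
      show m * n + n = (m + 1) * n by ring, h1, h2, lucasS_add_two]
    ring

theorem lucasS_dvd {m n : ℕ} (x : ℤ) (h : m ∣ n) : lucasS x m ∣ lucasS x n := by
  obtain ⟨c, rfl⟩ := h
  rw [mul_comm, lucasS_mul]
  exact dvd_mul_right _ _

theorem lucasV_sq (x : ℤ) (n : ℕ) :
    lucasV x n ^ 2 - 4 = (x ^ 2 - 4) * lucasS x n ^ 2 := by
  rw [lucasV]; linear_combination 4 * lucasS_cassini x n

theorem lucasS_neg (x : ℤ) (n : ℕ) : lucasS (-x) n = (-1) ^ (n + 1) * lucasS x n := by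
  induction n using Nat.twoStepInduction with
  | zero => simp
  | one => simp
  | more n h1 h2 => rw [lucasS_add_two, lucasS_add_two, h1, h2]; ring

theorem dvd_lucasS_neg_iff (m x : ℤ) (n : ℕ) : m ∣ lucasS (-x) n ↔ m ∣ lucasS x n := by
  rw [lucasS_neg]
  rcases neg_one_pow_eq_or ℤ (n + 1) with h | h <;> simp [h]

/-! ### Divisibility by primes and the law of repetition -/

/-- The expansion of `S_n(2 + y)` to second order in `y`. -/
theorem sq_dvd_lucasS_sub (x : ℤ) (n : ℕ) :
    (x - 2) ^ 2 ∣ 6 * lucasS x n - (6 * n + ((n : ℤ) ^ 3 - n) * (x - 2)) := by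
  induction n using Nat.twoStepInduction with
  | zero => simp
  | one => simp
  | more n h1 h2 =>
    obtain ⟨a, ha⟩ := h1
    obtain ⟨b, hb⟩ := h2
    push_cast at hb
    refine ⟨x * b - a + ((n + 1 : ℤ) ^ 3 - (n + 1)), ?_⟩
    rw [lucasS_add_two]
    push_cast
    linear_combination x * hb - ha

theorem sub_two_dvd_lucasS_sub (x : ℤ) (n : ℕ) : x - 2 ∣ lucasS x n - n := by
  induction n using Nat.twoStepInduction with
  | zero => simp
  | one => simp
  | more n h1 h2 =>
    obtain ⟨a, ha⟩ := h1
    obtain ⟨b, hb⟩ := h2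
    push_cast at hb
    refine ⟨x * b - a + (n + 1), ?_⟩
    rw [lucasS_add_two]
    push_cast
    linear_combination x * hb - ha

theorem dvd_lucasS_iff_of_dvd_sub_two {q x : ℤ} (h : q ∣ x - 2) (n : ℕ) :
    q ∣ lucasS x n ↔ q ∣ n :=
  (Int.dvd_iff_dvd_of_dvd_sub (h.trans (sub_two_dvd_lucasS_sub x n)))

theorem dvd_lucasS_iff_of_dvd_sub_two_or {q x : ℤ} (h : q ∣ x - 2 ∨ q ∣ x + 2) (n : ℕ) :
    q ∣ lucasS x n ↔ q ∣ n := by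
  rcases h with h | h
  · exact dvd_lucasS_iff_of_dvd_sub_two h n
  · rw [← dvd_lucasS_neg_iff]
    refine dvd_lucasS_iff_of_dvd_sub_two ?_ n
    rwa [← dvd_neg, show -(-x - 2) = x + 2 by ring]

/-- If a prime `p` divides `S_n`, then `p S_n` divides `S_{pn}`. -/
theorem prime_mul_lucasS_dvd {p : ℕ} (hp : p.Prime) (x : ℤ) {n : ℕ}
    (h : (p : ℤ) ∣ lucasS x n) : (p : ℤ) * lucasS x n ∣ lucasS x (p * n) := by
  rw [lucasS_mul, mul_comm (p : ℤ)]
  -- Since V_n² − 4 = (x² − 4) S_n², the new parameter V_n is ±2 mod p.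
  refine mul_dvd_mul_left _ ((dvd_lucasS_iff_of_dvd_sub_two_or ?_ p).2 dvd_rfl)
  refine (Nat.prime_iff_prime_int.1 hp).dvd_or_dvd ?_
  rw [show (lucasV x n - 2) * (lucasV x n + 2) = lucasV x n ^ 2 - 4 by ring, lucasV_sq]
  exact (dvd_pow h two_ne_zero).mul_left _

theorem mul_dvd_lucasS_prime_mul {p : ℕ} (hp : p.Prime) (x : ℤ) {t z s : ℕ}
    (ht : (t : ℤ) ∣ lucasS x z) (hs : (p : ℤ) ∣ lucasS x s) :
    ((p : ℤ) ∣ lucasS x z → ((p * t : ℕ) : ℤ) ∣ lucasS x (p * z)) ∧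
    (¬ (p : ℤ) ∣ lucasS x z → ((p * t : ℕ) : ℤ) ∣ lucasS x (s * z)) := by
  push_cast
  refine ⟨fun h => (mul_dvd_mul_left _ ht).trans (prime_mul_lucasS_dvd hp x h), fun h => ?_⟩
  have hpt : IsCoprime (p : ℤ) t := by
    rw [Nat.isCoprime_iff_coprime, hp.coprime_iff_not_dvd]
    exact fun h' => h ((Int.natCast_dvd_natCast.2 h').trans ht)
  exact hpt.mul_dvd (hs.trans (lucasS_dvd x (dvd_mul_right _ _)))
    (ht.trans (lucasS_dvd x (dvd_mul_left _ _)))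

theorem lucasV_sub_two_dvd {q x : ℤ} (h : q ∣ x - 2) (n : ℕ) : q ∣ lucasV x n - 2 := by
  have h1 := h.trans (sub_two_dvd_lucasS_sub x (n + 1))
  have h2 := h.trans (sub_two_dvd_lucasS_sub x n)
  have h3 := ((h1.mul_left 2).sub (h2.mul_left x)).sub (h.mul_left (n : ℤ))
  have e : lucasV x n - 2 = 2 * (lucasS x (n + 1) - ((n + 1 : ℕ) : ℤ)) -
      x * (lucasS x n - n) - n * (x - 2) := by
    rw [lucasV]; push_cast; ring
  rwa [e]

/-- For p > 3 the second-order expansion gives 6 S_p ≡ 6p mod p². For p = 3 and x = 2 + 3c, 9 ∣ x² −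
1 exactly when 3 ∣ 1 + c, that is x ≡ 8 mod 9. -/
theorem not_sq_dvd_lucasS_prime {p : ℕ} (hp : p.Prime) {x : ℤ} (hx : (p : ℤ) ∣ x - 2)
    (h2 : p = 2 → (4 : ℤ) ∣ x - 2) (h3 : p = 3 → ¬ (9 : ℤ) ∣ x - 8) :
    ¬ (p : ℤ) ^ 2 ∣ lucasS x p := by
  intro h
  by_cases e2 : p = 2
  · subst e2
    rw [lucasS_two] at h
    have := h2 rfl
    norm_num at h
    omega
  by_cases e3 : p = 3
  · subst e3
    rw [lucasS_three] at h
    obtain ⟨c, hc⟩ := hx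
    obtain ⟨d, hd⟩ := h
    refine h3 rfl ?_
    have hx' : x = 2 + 3 * c := by push_cast at hc; linarith
    subst hx'
    push_cast at hd
    have : 1 + c = 3 * (d - c - c ^ 2) := by linarith
    omega
  obtain ⟨c, hc⟩ := hx
  have h6 : (p : ℤ) ^ 2 ∣ (p : ℤ) * 6 := by
    have a1 : (p : ℤ) ^ 2 ∣ 6 * lucasS x p - (6 * p + ((p : ℤ) ^ 3 - p) * (x - 2)) :=
      (pow_dvd_pow_of_dvd ⟨c, hc⟩ 2).trans (sq_dvd_lucasS_sub x p)
    have a2 : (p : ℤ) ^ 2 ∣ ((p : ℤ) ^ 3 - p) * (x - 2) :=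
      ⟨((p : ℤ) ^ 2 - 1) * c, by rw [hc]; ring⟩
    have a3 := ((h.mul_left 6).sub a1).sub a2
    ring_nf at a3
    exact a3
  rw [pow_two] at h6
  have h6' : p ∣ 6 := by
    exact_mod_cast Int.dvd_of_mul_dvd_mul_left (by exact_mod_cast hp.ne_zero) h6
  have : p ∣ 2 * 3 := h6'
  rcases hp.dvd_mul.1 this with h | h
  · exact e2 ((Nat.prime_dvd_prime_iff_eq hp Nat.prime_two).1 h)
  · exact e3 ((Nat.prime_dvd_prime_iff_eq hp Nat.prime_three).1 h)

/-- Writing n = p n', S_n = S_p · S_{n'}(V_p), and S_p carries exactly one factor p, so the exponent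
drops by one and the parameter becomes V_p. -/
theorem prime_pow_dvd_of_dvd_lucasS {p : ℕ} (hp : p.Prime) (b : ℕ) :
    ∀ (x : ℤ) (n : ℕ), (p : ℤ) ∣ x - 2 → (p = 2 → (4 : ℤ) ∣ x - 2) →
      (b ≤ 1 ∨ (p = 3 → ¬ (9 : ℤ) ∣ x - 8)) → (p : ℤ) ^ b ∣ lucasS x n → p ^ b ∣ n := by
  induction b with
  | zero => simp
  | succ b ih =>
    intro x n hx h2 h3 h
    have hpn : p ∣ n := by
      have := (dvd_lucasS_iff_of_dvd_sub_two hx n).1 ((dvd_pow_self _ b.succ_ne_zero).trans h)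
      exact_mod_cast this
    rcases Nat.eq_zero_or_pos b with rfl | hb
    · simpa using hpn
    have h3' : p = 3 → ¬ (9 : ℤ) ∣ x - 8 := h3.resolve_left (by omega)
    obtain ⟨n, rfl⟩ := hpn
    rw [mul_comm p n, lucasS_mul] at h
    rw [pow_succ']
    refine mul_dvd_mul_left _ (ih (lucasV x p) n (lucasV_sub_two_dvd hx p) ?_ (Or.inr ?_) ?_)
    · exact fun e => lucasV_sub_two_dvd (h2 e) p
    -- V_3 ≡ 2 mod 9, so the exceptional class 8 cannot recur after the first step.
    · rintro rfl
      rw [lucasV_three]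
      obtain ⟨c, hc⟩ := hx
      have hx' : x = 2 + 3 * c := by push_cast at hc; linarith
      subst hx'
      have : (2 + 3 * c) ^ 3 - 3 * (2 + 3 * c) - 8 = 9 * (3 * c ^ 3 + 6 * c ^ 2 + 3 * c) - 6 := by
        ring
      rw [this]
      omega
    · have hpp : Prime (p : ℤ) := Nat.prime_iff_prime_int.1 hp
      obtain ⟨c, hc⟩ : (p : ℤ) ∣ lucasS x p := (dvd_lucasS_iff_of_dvd_sub_two hx p).2 dvd_rfl
      have hcp : ¬ (p : ℤ) ∣ c := fun ⟨d, hd⟩ =>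
        not_sq_dvd_lucasS_prime hp hx h2 h3' ⟨d, by rw [hc, hd]; ring⟩
      rw [hc, pow_succ', mul_assoc] at h
      have := Int.dvd_of_mul_dvd_mul_left hpp.ne_zero h
      exact hpp.pow_dvd_of_dvd_mul_left _ hcp this

/-! ### Moduli composed of primes dividing k(k + 1) -/

theorem prime_two_dvd_mul_succ (k : ℕ) : 2 ∣ k * (k + 1) := (Nat.even_mul_succ_self k).two_dvd

theorem prime_dvd_param {p k : ℕ} (hp : p.Prime) (h : p ∣ k * (k + 1)) :
    (p : ℤ) ∣ (4 * (k : ℤ) + 2) - 2 ∨ (p : ℤ) ∣ (4 * (k : ℤ) + 2) + 2 := by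
  rcases hp.dvd_mul.1 h with h | h
  · left
    have : (p : ℤ) ∣ (k : ℤ) := by exact_mod_cast h
    rw [show 4 * (k : ℤ) + 2 - 2 = 4 * k by ring]
    exact this.mul_left 4
  · right
    have : (p : ℤ) ∣ ((k + 1 : ℕ) : ℤ) := by exact_mod_cast h
    rw [show 4 * (k : ℤ) + 2 + 2 = 4 * ((k + 1 : ℕ) : ℤ) by push_cast; ring]
    exact this.mul_left 4

/-- The law of repetition at the primes dividing `k (k + 1)`. -/
theorem prime_pow_dvd_of_dvd_lucasU {p k : ℕ} (hp : p.Prime) (hpk : p ∣ k * (k + 1)) {b n : ℕ}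
    (h9 : b ≤ 1 ∨ (p = 3 → ¬ k ≡ 6 [MOD 9] ∧ ¬ k ≡ 2 [MOD 9]))
    (h : (p : ℤ) ^ b ∣ lucasU k n) : p ^ b ∣ n := by
  rw [lucasU_eq_lucasS] at h
  by_cases e2 : p = 2
  · subst e2
    exact prime_pow_dvd_of_dvd_lucasS hp b _ n ⟨2 * k, by push_cast; ring⟩
      (fun _ => ⟨k, by ring⟩) (Or.inr (by omega)) h
  rcases prime_dvd_param hp hpk with hk | hk
  · refine prime_pow_dvd_of_dvd_lucasS hp b _ n hk (fun e => absurd e e2) (h9.imp_right ?_) h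
    intro h3 e
    -- 4k + 2 ≡ 8 mod 9 means k ≡ 6; with the sign reversed below, it means k ≡ 2.
    have := (h3 e).1
    rw [Nat.ModEq] at this
    omega
  · rw [← dvd_lucasS_neg_iff] at h
    refine prime_pow_dvd_of_dvd_lucasS hp b _ n ?_ (fun e => absurd e e2) (h9.imp_right ?_) h
    · rwa [← dvd_neg, show -(-(4 * (k : ℤ) + 2) - 2) = 4 * (k : ℤ) + 2 + 2 by ring]
    intro h3 e
    have := (h3 e).2
    rw [Nat.ModEq] at this
    omega

theorem dvd_of_dvd_lucasU {k m n : ℕ} (hm : ∀ p : ℕ, p.Prime → p ∣ m → p ∣ k * (k + 1))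
    (h9 : 9 ∣ m → ¬ k ≡ 6 [MOD 9] ∧ ¬ k ≡ 2 [MOD 9]) (h : (m : ℤ) ∣ lucasU k n) : m ∣ n := by
  rw [Nat.dvd_iff_prime_pow_dvd_dvd]
  intro p b hp hb
  rcases Nat.eq_zero_or_pos b with rfl | hb0
  · simp
  refine prime_pow_dvd_of_dvd_lucasU hp (hm p hp ((dvd_pow_self _ hb0.ne').trans hb)) ?_ ?_
  · by_cases hb1 : b ≤ 1
    · exact Or.inl hb1
    · refine Or.inr fun e => h9 ?_
      subst e
      exact (pow_dvd_pow 3 (by omega : 2 ≤ b)).trans hb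
  · exact (by exact_mod_cast hb : ((p : ℤ) ^ b ∣ m)).trans h

theorem dvd_lucasU_self {k m : ℕ} (hm : ∀ p : ℕ, p.Prime → p ∣ m → p ∣ k * (k + 1)) :
    (m : ℤ) ∣ lucasU k m := by
  rw [lucasU_eq_lucasS]
  induction m using induction_on_primes with
  | zero => simp
  | one => simp
  | prime_mul p t hp ih =>
    have hp' : p.Prime := hp
    have iht := ih fun q hq hqt => hm q hq (hqt.mul_left _)
    have hpp : (p : ℤ) ∣ lucasS (4 * (k : ℤ) + 2) p :=
      (dvd_lucasS_iff_of_dvd_sub_two_or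
        (prime_dvd_param hp' (hm p hp' (dvd_mul_right _ _))) p).2 dvd_rfl
    obtain ⟨h1, h2⟩ := mul_dvd_lucasS_prime_mul hp' _ iht hpp
    exact (em _).elim h1 h2

theorem isCoprime_of_primes {m : ℕ} {a b : ℤ} (hb : ∀ p : ℕ, p.Prime → p ∣ m → (p : ℤ) ∣ b)
    (h : a ^ 2 - 1 = b) : IsCoprime (m : ℤ) a := by
  rw [Int.isCoprime_iff_gcd_eq_one]
  by_contra hne
  obtain ⟨p, hp, hd⟩ := Nat.exists_prime_and_dvd hne
  have h1 : (p : ℤ) ∣ m := (Int.natCast_dvd_natCast.2 hd).trans (Int.gcd_dvd_left _ _)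
  have h2 : (p : ℤ) ∣ a := (Int.natCast_dvd_natCast.2 hd).trans (Int.gcd_dvd_right _ _)
  have h3 := hb p hp (by exact_mod_cast h1)
  have h4 : (p : ℤ) ∣ 1 := by
    have := (dvd_pow h2 two_ne_zero).sub h3
    rwa [← h, sub_sub_cancel] at this
  have h5 : p ∣ 1 := by exact_mod_cast h4
  exact hp.one_lt.ne' (Nat.dvd_one.1 h5)

/-- Cassini gives (U_{e+1} − U_e)² = 1 + 4k U_{e+1} U_e; the two variants below have 4(k + 1)
U_{e+1} U_e and 4k(k + 1) U_e² in place of the last term. -/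
theorem isCoprime_lucasU_sub {k m : ℕ} (hm : ∀ p : ℕ, p.Prime → p ∣ m → p ∣ k) (e : ℕ) :
    IsCoprime (m : ℤ) (lucasU k (e + 1) - lucasU k e) := by
  simp only [lucasU_eq_lucasS]
  refine isCoprime_of_primes (b := k * (4 * lucasS (4 * (k : ℤ) + 2) (e + 1) *
    lucasS (4 * (k : ℤ) + 2) e)) (fun p hp h => ?_) ?_
  · exact (Int.natCast_dvd_natCast.2 (hm p hp h)).mul_right _
  · linear_combination lucasS_cassini (4 * (k : ℤ) + 2) e

theorem isCoprime_lucasU_add {k m : ℕ} (hm : ∀ p : ℕ, p.Prime → p ∣ m → p ∣ k + 1) (e : ℕ) :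
    IsCoprime (m : ℤ) (lucasU k (e + 1) + lucasU k e) := by
  simp only [lucasU_eq_lucasS]
  refine isCoprime_of_primes (b := ((k + 1 : ℕ) : ℤ) * (4 * lucasS (4 * (k : ℤ) + 2) (e + 1) *
    lucasS (4 * (k : ℤ) + 2) e)) (fun p hp h => ?_) ?_
  · exact (Int.natCast_dvd_natCast.2 (hm p hp h)).mul_right _
  · push_cast
    linear_combination lucasS_cassini (4 * (k : ℤ) + 2) e

theorem isCoprime_half_lucasV {k m : ℕ} (hm : ∀ p : ℕ, p.Prime → p ∣ m → p ∣ k * (k + 1))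
    (e : ℕ) : ∃ w : ℤ, lucasV (4 * (k : ℤ) + 2) e = 2 * w ∧ IsCoprime (m : ℤ) w := by
  refine ⟨lucasS (4 * (k : ℤ) + 2) (e + 1) - (2 * k + 1) * lucasS (4 * (k : ℤ) + 2) e,
    by rw [lucasV]; ring, ?_⟩
  refine isCoprime_of_primes (b := ((k * (k + 1) : ℕ) : ℤ) *
    (4 * lucasS (4 * (k : ℤ) + 2) e ^ 2)) (fun p hp h => ?_) ?_
  · exact (Int.natCast_dvd_natCast.2 (hm p hp h)).mul_right _
  · push_cast
    linear_combination lucasS_cassini (4 * (k : ℤ) + 2) e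

theorem dvd_lucasU_of_even_diff {k m : ℕ} (hm : ∀ p : ℕ, p.Prime → p ∣ m → p ∣ k * (k + 1))
    {j d : ℕ} (h : (m : ℤ) ∣ lucasU k (j + 2 * d) - lucasU k j) :
    (m : ℤ) ∣ lucasU k (2 * d) := by
  simp only [lucasU_eq_lucasS] at h ⊢
  obtain ⟨w, hw, hc⟩ := isCoprime_half_lucasV hm (j + d)
  obtain ⟨v, hv, -⟩ := isCoprime_half_lucasV hm d
  rw [lucasS_add_two_mul_sub, hw, ← mul_assoc] at h
  rw [lucasS_two_mul, hv, ← mul_assoc]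
  exact (hc.dvd_of_dvd_mul_right h).mul_right _

theorem dvd_lucasU_of_odd_diff {k m : ℕ} (hm : ∀ p : ℕ, p.Prime → p ∣ m → p ∣ k)
    {j d : ℕ} (h : (m : ℤ) ∣ lucasU k (j + (2 * d + 1)) - lucasU k j) :
    (m : ℤ) ∣ lucasU k (2 * d + 1) := by
  have hc := isCoprime_lucasU_sub hm (j + d)
  simp only [lucasU_eq_lucasS] at h hc ⊢
  rw [lucasS_add_two_mul_add_one_sub] at h
  rw [lucasS_two_mul_add_one]
  exact (hc.dvd_of_dvd_mul_right h).mul_right _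

theorem two_dvd_lucasU_iff (k n : ℕ) : (2 : ℤ) ∣ lucasU k n ↔ 2 ∣ n := by
  rw [lucasU_eq_lucasS, dvd_lucasS_iff_of_dvd_sub_two ⟨2 * (k : ℤ), by ring⟩]
  exact_mod_cast Iff.rfl

theorem two_dvd_of_dvd_lucasU_sub {k j d : ℕ} (h : (2 : ℤ) ∣ lucasU k (j + d) - lucasU k j) :
    2 ∣ d := by
  have h1 := two_dvd_lucasU_iff k (j + d)
  have h2 := two_dvd_lucasU_iff k j
  omega

theorem dvd_of_dvd_lucasU_sub {k m : ℕ} (hm : m ∈ setA k ∪ setB k) {j d : ℕ}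
    (h : (m : ℤ) ∣ lucasU k (j + d) - lucasU k j) : m ∣ d := by
  have hall : ∀ p : ℕ, p.Prime → p ∣ m → p ∣ k * (k + 1) := by
    rcases hm with ⟨-, -, hm, -⟩ | ⟨-, -, hm, -⟩
    · exact fun p hp hpm => (hm p hp hpm).mul_right _
    · exact hm
  have h9 : 9 ∣ m → ¬ k ≡ 6 [MOD 9] ∧ ¬ k ≡ 2 [MOD 9] := by
    rcases hm with ⟨-, -, hm, hm'⟩ | ⟨-, -, -, hm'⟩
    · intro h9
      have h3 := hm 3 Nat.prime_three (dvd_trans (by norm_num) h9)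
      refine ⟨fun h => hm' h h9, fun h => ?_⟩
      rw [Nat.ModEq] at h
      omega
    · exact fun h9 => ⟨fun h => hm' (Or.inr h) h9, fun h => hm' (Or.inl h) h9⟩
  refine dvd_of_dvd_lucasU hall h9 ?_
  obtain ⟨c, rfl | rfl⟩ := d.even_or_odd'
  · exact dvd_lucasU_of_even_diff hall h
  · rcases hm with ⟨-, -, hm, -⟩ | ⟨-, hev, -, -⟩
    · exact dvd_lucasU_of_odd_diff hm h
    -- U_n has the parity of n, so an even modulus rules out odd distances.
    · have := two_dvd_of_dvd_lucasU_sub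
        ((show (2 : ℤ) ∣ m by exact_mod_cast hev.two_dvd).trans h)
      omega

/-! ### Discriminating moduli -/

theorem pos_of_mem {k m : ℕ} (hm : m ∈ setA k ∪ setB k) : 0 < m := by
  rcases hm with hm | hm <;> exact hm.1

theorem discriminates_of_forall_lt {a : ℕ → ℤ} {n m : ℕ} (hm : 1 ≤ m)
    (h : ∀ j d, 0 < d → j + d < n → ¬ (m : ℤ) ∣ a (j + d) - a j) : Discriminates a n m := by
  refine ⟨hm, fun i hi j hj hij hc => ?_⟩
  rcases lt_or_gt_of_ne hij with hlt | hlt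
  · obtain ⟨d, rfl⟩ := Nat.exists_eq_add_of_lt hlt
    exact h i (d + 1) (by omega) (by omega) hc.dvd
  · obtain ⟨d, rfl⟩ := Nat.exists_eq_add_of_lt hlt
    exact h j (d + 1) (by omega) (by omega) hc.symm.dvd

theorem discriminates_self_of_mem {k m : ℕ} (hm : m ∈ setA k ∪ setB k) :
    Discriminates (lucasU k) m m :=
  discriminates_of_forall_lt (pos_of_mem hm) fun j d hd hjd h => by
    have := Nat.le_of_dvd hd (dvd_of_dvd_lucasU_sub hm h)
    omega

theorem Discriminates.mono {a : ℕ → ℤ} {n n' m : ℕ} (h : Discriminates a n m) (hn : n' ≤ n) :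
    Discriminates a n' m :=
  ⟨h.1, fun i hi j hj => h.2 i (hi.trans_le hn) j (hj.trans_le hn)⟩

theorem Discriminates.le {a : ℕ → ℤ} {n m : ℕ} (h : Discriminates a n m) : n ≤ m := by
  have : NeZero m := ⟨by have := h.1; omega⟩
  have hinj : Function.Injective fun i : Fin n => ((a i : ℤ) : ZMod m) := by
    intro i j hij
    by_contra hne
    exact h.2 i i.2 j j.2 (fun e => hne (Fin.ext e)) ((ZMod.intCast_eq_intCast_iff _ _ _).1 hij)
  simpa using Fintype.card_le_of_injective _ hinj

theorem Discriminates.le_of_dvd_sub {a : ℕ → ℤ} {n m i j : ℕ} (h : Discriminates a n m)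
    (hij : i < j) (hd : (m : ℤ) ∣ a j - a i) : n ≤ j := by
  by_contra hlt
  exact h.2 i (by omega) j (by omega) hij.ne (Int.modEq_iff_dvd.2 hd)

theorem Discriminates.le_rank {k n m z : ℕ} (h : Discriminates (lucasU k) n m) (hz : 0 < z)
    (hd : (m : ℤ) ∣ lucasU k z) : n ≤ z :=
  h.le_of_dvd_sub hz (by simpa [lucasU] using hd)

theorem discriminator_le {a : ℕ → ℤ} {n m : ℕ} (h : Discriminates a n m) :
    discriminator a n ≤ m := Nat.sInf_le h

/-! ### Small ranks at the remaining primes -/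

/-- Binet's formula with the root written as the square (√(k+1) + √k)²; this square root is what
halves the rank from p ± 1. -/
theorem cast_lucasU_mul_eq {K : Type*} [Field K] {k : ℕ} {a b : K} (ha : a ^ 2 = k)
    (hb : b ^ 2 = (k : K) + 1) (n : ℕ) :
    (lucasU k n : K) * (4 * a * b) = (b + a) ^ (2 * n) - (b - a) ^ (2 * n) := by
  induction n using Nat.twoStepInduction with
  | zero => simp [lucasU]
  | one => simp [lucasU]; ring
  | more n h1 h2 =>
    rw [lucasU]
    push_cast
    have hk : (k : K) = a ^ 2 := ha.symm
    rw [hk] at hb ⊢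
    have e1 : (b + a) ^ 2 * (b - a) ^ 2 = 1 := by linear_combination (b ^ 2 - a ^ 2 + 1) * hb
    have e2 : (b + a) ^ 2 + (b - a) ^ 2 = 4 * a ^ 2 + 2 := by linear_combination 2 * hb
    rw [← e2]
    have h2' : (lucasU k (n + 1) : K) * (4 * a * b)
      = (b + a) ^ (2 * n) * (b + a) ^ 2 - (b - a) ^ (2 * n) * (b - a) ^ 2 := by
      rw [h2]; ring
    have g1 : (b + a) ^ (2 * (n + 2)) = (b + a) ^ (2 * n) * ((b + a) ^ 2 * (b + a) ^ 2) := by ring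
    have g2 : (b - a) ^ (2 * (n + 2)) = (b - a) ^ (2 * n) * ((b - a) ^ 2 * (b - a) ^ 2) := by ring
    rw [g1, g2]
    linear_combination ((b + a) ^ 2 + (b - a) ^ 2) * h2' - h1 +
      ((b + a) ^ (2 * n) - (b - a) ^ (2 * n)) * e1

/-- Frobenius fixes a and b up to sign, so (b + a)^p is ±(b + a) or ±(b + a)⁻¹, with b − a = (b +
a)⁻¹. Thus s = (p ∓ 1)/2 works, and (p + 1)/2 ≤ 2p/3 because p ≥ 3. -/
theorem exists_prime_dvd_lucasU_of_field {p k : ℕ} (K : Type*) [Field K] [IsAlgClosed K]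
    [CharP K p] (hp : p.Prime) (hpk : ¬ p ∣ k * (k + 1)) :
    ∃ s, 0 < s ∧ 3 * s ≤ 2 * p ∧ (p : ℤ) ∣ lucasU k s := by
  have : Fact p.Prime := ⟨hp⟩
  have hp2 : p ≠ 2 := by
    rintro rfl
    exact hpk (prime_two_dvd_mul_succ k)
  have hp3 : 3 ≤ p := by have := hp.two_le; omega
  obtain ⟨q, hq⟩ := hp.odd_of_ne_two hp2
  obtain ⟨a, ha⟩ := IsAlgClosed.exists_pow_nat_eq (k : K) (n := 2) (by norm_num)
  obtain ⟨b, hb⟩ := IsAlgClosed.exists_pow_nat_eq ((k : K) + 1) (n := 2) (by norm_num)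
  have hinv : (b + a) * (b - a) = 1 := by linear_combination hb - ha
  have hne : 4 * a * b ≠ 0 := by
    intro h0
    have h1 : ((16 * (k * (k + 1)) : ℕ) : K) = 0 := by
      push_cast
      linear_combination (4 * a * b) * h0 - 16 * b ^ 2 * ha - 16 * (k : K) * hb
    rw [CharP.cast_eq_zero_iff K p] at h1
    rcases hp.dvd_mul.1 h1 with h | h
    · exact hp2 ((Nat.prime_dvd_prime_iff_eq hp Nat.prime_two).1
        (hp.dvd_of_dvd_pow (show p ∣ 2 ^ 4 by simpa using h)))
    · exact hpk h
  have hfk : (k : K) ^ p = k := map_natCast (frobenius K p) k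
  have hap : a ^ p = a ∨ a ^ p = -a := by
    rw [← sq_eq_sq_iff_eq_or_eq_neg, ← pow_mul, mul_comm, pow_mul, ha, hfk]
  have hbp : b ^ p = b ∨ b ^ p = -b := by
    rw [← sq_eq_sq_iff_eq_or_eq_neg, ← pow_mul, mul_comm, pow_mul, hb, add_pow_char, hfk, one_pow]
  have key : ∀ s, (b + a) ^ (2 * s) = (b - a) ^ (2 * s) → (p : ℤ) ∣ lucasU k s := by
    intro s hs
    have h := cast_lucasU_mul_eq ha hb s
    rw [hs, sub_self] at h
    rw [← CharP.intCast_eq_zero_iff K p]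
    exact (mul_eq_zero.1 h).resolve_right hne
  have hplus : (b + a) ^ p = b ^ p + a ^ p := add_pow_char _ _ _
  have hminus : (b - a) ^ p = b ^ p - a ^ p := sub_pow_char _ _
  have up : (b + a) ^ p * (b + a) = (b - a) ^ p * (b - a) → (p : ℤ) ∣ lucasU k (q + 1) := by
    intro h
    refine key _ ?_
    rw [show 2 * (q + 1) = p + 1 by omega, pow_succ, pow_succ, h]
  have down : (b + a) ^ p * (b - a) = (b - a) ^ p * (b + a) → (p : ℤ) ∣ lucasU k q := by
    intro h
    refine key _ ?_
    have e1 : (b + a) ^ p * (b - a) = (b + a) ^ (2 * q) := by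
      rw [congrArg (_ ^ ·) hq, pow_succ, mul_assoc, hinv, mul_one]
    have e2 : (b - a) ^ p * (b + a) = (b - a) ^ (2 * q) := by
      rw [congrArg (_ ^ ·) hq, pow_succ, mul_assoc, mul_comm (b - a), hinv, mul_one]
    rw [← e1, ← e2, h]
  rw [hplus, hminus] at up down
  rcases hap with h1 | h1 <;> rcases hbp with h2 | h2 <;> rw [h1, h2] at up down
  · exact ⟨q, by omega, by omega, down (by ring)⟩
  · exact ⟨q + 1, by omega, by omega, up (by ring)⟩
  · exact ⟨q + 1, by omega, by omega, up (by ring)⟩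
  · exact ⟨q, by omega, by omega, down (by ring)⟩

/-- An odd prime `p` not dividing `k (k + 1)` divides `U_s` for `s = (p - 1) / 2` or
`s = (p + 1) / 2`. -/
theorem exists_prime_dvd_lucasU {p k : ℕ} (hp : p.Prime) (hpk : ¬ p ∣ k * (k + 1)) :
    ∃ s, 0 < s ∧ 3 * s ≤ 2 * p ∧ (p : ℤ) ∣ lucasU k s := by
  have : Fact p.Prime := ⟨hp⟩
  have : CharP (AlgebraicClosure (ZMod p)) p :=
    charP_of_injective_algebraMap (algebraMap (ZMod p) _).injective p
  exact exists_prime_dvd_lucasU_of_field (AlgebraicClosure (ZMod p)) hp hpk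

theorem exists_prime_dvd_lucasU_le {p : ℕ} (hp : p.Prime) (k : ℕ) :
    ∃ s, 0 < s ∧ s ≤ p ∧ (p : ℤ) ∣ lucasU k s := by
  by_cases hpk : p ∣ k * (k + 1)
  · refine ⟨p, hp.pos, le_rfl, dvd_lucasU_self fun q hq hqp => ?_⟩
    rwa [(Nat.prime_dvd_prime_iff_eq hq hp).1 hqp]
  · obtain ⟨s, h0, h1, h2⟩ := exists_prime_dvd_lucasU hp hpk
    exact ⟨s, h0, by omega, h2⟩

/-- Each extra prime p in the modulus multiplies the index by at most p, so a bound on z/m passes to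
all multiples of m. -/
theorem exists_rank_mul_le {k m z : ℕ} (hz : 0 < z) (h : (m : ℤ) ∣ lucasU k z) (t : ℕ)
    (ht : t ≠ 0) : ∃ z', 0 < z' ∧ z' ≤ z * t ∧ ((m * t : ℕ) : ℤ) ∣ lucasU k z' := by
  induction t using induction_on_primes with
  | zero => exact absurd rfl ht
  | one => exact ⟨z, hz, by simp, by simpa using h⟩
  | prime_mul p t hp ih =>
    have hp' : p.Prime := hp
    obtain ⟨w, hw0, hw1, hw⟩ := ih (by rintro rfl; simp at ht)
    obtain ⟨s, hs0, hs1, hs⟩ := exists_prime_dvd_lucasU_le hp' k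
    rw [lucasU_eq_lucasS] at hw hs
    obtain ⟨h1, h2⟩ := mul_dvd_lucasS_prime_mul hp' _ hw hs
    have hle : p * w ≤ z * (p * t) := by
      calc p * w ≤ p * (z * t) := Nat.mul_le_mul_left _ hw1
        _ = z * (p * t) := by ring
    rw [show m * (p * t) = p * (m * t) by ring]
    by_cases hc : (p : ℤ) ∣ lucasS (4 * (k : ℤ) + 2) w
    · exact ⟨p * w, Nat.mul_pos hp'.pos hw0, hle, by rw [lucasU_eq_lucasS]; exact h1 hc⟩
    · exact ⟨s * w, Nat.mul_pos hs0 hw0, (Nat.mul_le_mul_right _ hs1).trans hle,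
        by rw [lucasU_eq_lucasS]; exact h2 hc⟩

theorem Discriminates.le_of_rank {k n m z t : ℕ} (h : Discriminates (lucasU k) n t)
    (hz : 0 < z) (hzm : 3 * z ≤ 2 * m) (hd : (m : ℤ) ∣ lucasU k z) (hm : m ∣ t) :
    3 * n ≤ 2 * t := by
  obtain ⟨c, rfl⟩ := hm
  have hc : c ≠ 0 := by
    rintro rfl
    have := h.1
    omega
  obtain ⟨z', h0, h1, h2⟩ := exists_rank_mul_le hz hd c hc
  have := h.le_rank h0 h2
  nlinarith [Nat.mul_le_mul_right c hzm]

/-! ### Moduli outside the two sets -/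

theorem exists_mul_of_primes_dvd_mul {a b m : ℕ} (hm0 : m ≠ 0)
    (hm : ∀ p : ℕ, p.Prime → p ∣ m → p ∣ a * b) :
    ∃ u v, m = u * v ∧ (∀ p : ℕ, p.Prime → p ∣ u → p ∣ a) ∧
      (∀ p : ℕ, p.Prime → p ∣ v → p ∣ b) := by
  induction m using induction_on_primes with
  | zero => exact absurd rfl hm0
  | one =>
    exact ⟨1, 1, rfl, fun p hp h => absurd (Nat.dvd_one.1 h) hp.ne_one,
      fun p hp h => absurd (Nat.dvd_one.1 h) hp.ne_one⟩
  | prime_mul q t hq ih =>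
    have hq' : q.Prime := hq
    obtain ⟨u, v, rfl, hu, hv⟩ := ih (by rintro rfl; simp at hm0)
      fun p hp h => hm p hp (h.mul_left _)
    rcases hq'.dvd_mul.1 (hm q hq' (dvd_mul_right _ _)) with h | h
    · refine ⟨q * u, v, by ring, fun p hp hpu => ?_, hv⟩
      rcases hp.dvd_mul.1 hpu with h' | h'
      · rwa [(Nat.prime_dvd_prime_iff_eq hp hq').1 h']
      · exact hu p hp h'
    · refine ⟨u, q * v, by ring, hu, fun p hp hpv => ?_⟩
      rcases hp.dvd_mul.1 hpv with h' | h'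
      · rwa [(Nat.prime_dvd_prime_iff_eq hp hq').1 h']
      · exact hv p hp h'

theorem dvd_lucasU_sub_of_odd {k u v : ℕ} (huo : Odd u) (hvo : Odd v)
    (hu : ∀ p : ℕ, p.Prime → p ∣ u → p ∣ k) (hv : ∀ p : ℕ, p.Prime → p ∣ v → p ∣ k + 1) :
    ∃ j, 2 * (j + u) = u * (v + 1) ∧
      ((u * v : ℕ) : ℤ) ∣ lucasU k (j + u) - lucasU k j := by
  obtain ⟨d, hd⟩ := huo
  obtain ⟨e, he⟩ := hvo
  -- With u = 2d + 1 and j = ue, the difference is (U_{d+1} + U_d)(U_{f+1} − U_f), where 2f + 1 =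
  -- uv. The first factor absorbs u, being a factor of U_u with cofactor prime to u; the second
  -- likewise absorbs v from U_{uv}.
  obtain ⟨f, hf⟩ : ∃ f, f = u * e + d := ⟨_, rfl⟩
  have huv : u * v = 2 * f + 1 := by
    rw [he, hf, mul_add, mul_one]
    nth_rw 2 [hd]
    ring
  have hm : ∀ p : ℕ, p.Prime → p ∣ u * v → p ∣ k * (k + 1) := fun p hp h =>
    (hp.dvd_mul.1 h).elim (fun h => (hu p hp h).mul_right _) (fun h => (hv p hp h).mul_left _)
  refine ⟨u * e, by rw [he]; ring, ?_⟩
  have h1 : (u : ℤ) ∣ lucasU k (d + 1) + lucasU k d := by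
    have h := dvd_lucasU_self (m := u) fun p hp h => hm p hp (h.mul_right _)
    have hc := isCoprime_lucasU_sub hu d
    nth_rw 2 [hd] at h
    simp only [lucasU_eq_lucasS] at h hc ⊢
    rw [lucasS_two_mul_add_one] at h
    exact hc.dvd_of_dvd_mul_right h
  have h2 : (v : ℤ) ∣ lucasU k (f + 1) - lucasU k f := by
    have h := dvd_lucasU_self hm
    have hc := isCoprime_lucasU_add hv f
    nth_rw 2 [huv] at h
    replace h := (show (v : ℤ) ∣ ((u * v : ℕ) : ℤ) by push_cast; exact dvd_mul_left _ _).trans h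
    simp only [lucasU_eq_lucasS] at h hc ⊢
    rw [lucasS_two_mul_add_one] at h
    exact hc.dvd_of_dvd_mul_left h
  have h3 := mul_dvd_mul h1 h2
  push_cast
  nth_rw 3 [hd]
  simp only [lucasU_eq_lucasS] at h3 ⊢
  rw [lucasS_add_two_mul_add_one_sub, ← hf]
  exact h3

theorem nine_dvd_lucasU_three {k : ℕ} (h : k ≡ 2 [MOD 9] ∨ k ≡ 6 [MOD 9]) :
    (9 : ℤ) ∣ lucasU k 3 := by
  rw [lucasU_eq_lucasS, lucasS_three]
  obtain ⟨c, hc⟩ : ∃ c : ℕ, k = 9 * c + 2 ∨ k = 9 * c + 6 :=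
    ⟨k / 9, by rcases h with h | h <;> rw [Nat.ModEq] at h <;> omega⟩
  rcases hc with rfl | rfl
  · exact ⟨144 * c ^ 2 + 80 * c + 11, by push_cast; ring⟩
  · exact ⟨144 * c ^ 2 + 208 * c + 75, by push_cast; ring⟩

/-- A modulus outside `setA k ∪ setB k` discriminates at most two thirds as many terms as its
size. -/
theorem Discriminates.three_mul_le {k n m : ℕ} (h : Discriminates (lucasU k) n m)
    (hm : m ∉ setA k ∪ setB k) : 3 * n ≤ 2 * m := by
  have hm0 : 0 < m := h.1
  by_cases hall : ∀ p : ℕ, p.Prime → p ∣ m → p ∣ k * (k + 1)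
  swap
  · push Not at hall
    obtain ⟨p, hp, hpm, hpk⟩ := hall
    obtain ⟨s, h0, h1, h2⟩ := exists_prime_dvd_lucasU hp hpk
    exact h.le_of_rank h0 h1 h2 hpm
  by_cases h9 : (k ≡ 2 [MOD 9] ∨ k ≡ 6 [MOD 9]) ∧ 9 ∣ m
  · exact h.le_of_rank (z := 3) (m := 9) (by norm_num) (by norm_num)
      (by exact_mod_cast nine_dvd_lucasU_three h9.1) h9.2
  have hodd : Odd m := by
    by_contra hev
    exact hm (Or.inr ⟨hm0, Nat.not_odd_iff_even.1 hev, hall, fun h1 h2 => h9 ⟨h1, h2⟩⟩)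
  obtain ⟨u, v, rfl, hu, hv⟩ := exists_mul_of_primes_dvd_mul hm0.ne' hall
  obtain ⟨huo, hvo⟩ := Nat.odd_mul.1 hodd
  have hv1 : v ≠ 1 := by
    rintro rfl
    refine hm (Or.inl ⟨hm0, hodd, by simpa using hu, fun h1 h2 => h9 ⟨Or.inr h1, h2⟩⟩)
  have hv3 : 3 ≤ v := by
    obtain ⟨c, rfl⟩ := hvo
    omega
  obtain ⟨j, hj, hd⟩ := dvd_lucasU_sub_of_odd huo hvo hu hv
  -- The collision is at index u(v + 1)/2, at most 2uv/3 as v ≥ 3.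
  have := h.le_of_dvd_sub (i := j) (j := j + u) (by have := huo.pos; omega) hd
  nlinarith [Nat.mul_le_mul_left u hv3]

theorem discriminator_mem_of_exists {k n : ℕ} (hk : 1 ≤ k)
    (h : ∃ m ∈ setA k ∪ setB k, n ≤ m ∧ 2 * m < 3 * n) :
    discriminator (lucasU k) n ∈ setA k ∪ setB k := by
  by_contra hn
  obtain ⟨m, hm, hnm, hlt⟩ := h
  have h1 := (discriminates_discriminator _ (lucasU_strictMono k hk) n).three_mul_le hn
  have h2 := discriminator_le ((discriminates_self_of_mem hm).mono hnm)
  omega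

theorem subset_discriminatorValues {k : ℕ} (hk : 1 ≤ k) :
    setA k ∪ setB k ⊆ discriminatorValues (lucasU k) := fun m hm =>
  ⟨m, pos_of_mem hm, le_antisymm (discriminator_le (discriminates_self_of_mem hm))
    (discriminates_discriminator _ (lucasU_strictMono k hk) m).le⟩

/-! ### Elements of the sets in [n, 3n/2) -/

/-- If `u < v ≤ 3u/2`, then every large interval `[n, 3n/2)` contains a number
`2 ^ a u ^ i v ^ j` with `a ≥ 1`. -/
theorem exists_two_pow_mul_mem {u v : ℕ} (hu : 0 < u) (huv : u < v) (hvu : 2 * v ≤ 3 * u) :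
    ∃ N, ∀ n, N ≤ n → ∃ a i j, 0 < a ∧ n ≤ 2 ^ a * (u ^ i * v ^ j) ∧
      2 * (2 ^ a * (u ^ i * v ^ j)) < 3 * n := by
  -- Trading J factors u for v, one at a time, spans a full doubling in steps of ratio at most 3/2.
  obtain ⟨J, hJ⟩ : ∃ J, 2 * u ^ J ≤ v ^ J := by
    have hr : (1 : ℝ) < (v : ℝ) / u := by
      rw [one_lt_div (by exact_mod_cast hu)]; exact_mod_cast huv
    obtain ⟨J, hJ⟩ := pow_unbounded_of_one_lt 2 hr
    refine ⟨J, ?_⟩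
    rw [div_pow, lt_div_iff₀ (by positivity)] at hJ
    exact_mod_cast hJ.le
  -- This threshold forces b ≥ 2, leaving a = b − 1 ≥ 1.
  refine ⟨2 * u ^ J + 1, fun n hn => ?_⟩
  have hex : ∃ a, n ≤ 2 ^ a * u ^ J :=
    ⟨n, (Nat.lt_two_pow_self).le.trans (Nat.le_mul_of_pos_right _ (by positivity))⟩
  classical
  obtain ⟨b, hb⟩ : ∃ b, Nat.find hex = b := ⟨_, rfl⟩
  have hb1 := Nat.find_spec hex
  have hb2 : ∀ c < b, 2 ^ c * u ^ J < n := fun c hc => by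
    rw [← hb] at hc
    exact not_le.1 (Nat.find_min hex hc)
  rw [hb] at hb1
  have hb3 : 2 ≤ b := by
    by_contra hlt
    have : 2 ^ b * u ^ J ≤ 2 ^ 1 * u ^ J :=
      Nat.mul_le_mul_right _ (Nat.pow_le_pow_right (by norm_num) (by omega))
    omega
  obtain ⟨a, rfl⟩ : ∃ a, b = a + 1 := ⟨b - 1, by omega⟩
  have hex' : ∃ j, n ≤ 2 ^ a * (u ^ (J - j) * v ^ j) := by
    refine ⟨J, hb1.trans ?_⟩
    rw [Nat.sub_self, pow_zero, one_mul, pow_succ, mul_assoc]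
    exact Nat.mul_le_mul_left _ hJ
  obtain ⟨j, hj⟩ : ∃ j, Nat.find hex' = j := ⟨_, rfl⟩
  have hj1 := Nat.find_spec hex'
  have hj2 : ∀ c < j, 2 ^ a * (u ^ (J - c) * v ^ c) < n := fun c hc => by
    rw [← hj] at hc
    exact not_le.1 (Nat.find_min hex' hc)
  have hjJ : j ≤ J := by
    rw [← hj]
    refine Nat.find_min' hex' (hb1.trans ?_)
    rw [Nat.sub_self, pow_zero, one_mul, pow_succ, mul_assoc]
    exact Nat.mul_le_mul_left _ hJ
  rw [hj] at hj1
  refine ⟨a, J - j, j, by omega, hj1, ?_⟩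
  cases j with
  | zero =>
    have := hb2 a (by omega)
    simp at hj1
    omega
  | succ i =>
    have h := hj2 i (by omega)
    rw [show J - i = (J - (i + 1)) + 1 by omega, pow_succ] at h
    rw [pow_succ]
    have e : 2 ^ a * (u ^ (J - (i + 1)) * u * v ^ i) =
      u * (2 ^ a * (u ^ (J - (i + 1)) * v ^ i)) := by ring
    rw [e] at h
    have e' : 2 ^ a * (u ^ (J - (i + 1)) * (v ^ i * v)) =
      v * (2 ^ a * (u ^ (J - (i + 1)) * v ^ i)) := by ring
    rw [e']
    nlinarith [Nat.mul_le_mul_right (2 ^ a * (u ^ (J - (i + 1)) * v ^ i)) hvu]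

/-- For 2^c < p < 2^{c+1}, the ratios p/2^c and 2^{c+1}/p multiply to 2, so at least one is at most
3/2. -/
theorem exists_two_pow_mul_pow_mem {p : ℕ} (hp : p.Prime) (hp2 : p ≠ 2) :
    ∃ N, ∀ n, N ≤ n → ∃ a j, 0 < a ∧ n ≤ 2 ^ a * p ^ j ∧ 2 * (2 ^ a * p ^ j) < 3 * n := by
  have hc1 : 2 ^ Nat.log 2 p ≤ p := Nat.pow_log_le_self 2 hp.ne_zero
  have hc2 : p < 2 ^ (Nat.log 2 p + 1) := Nat.lt_pow_succ_log_self (by norm_num) p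
  generalize Nat.log 2 p = c at hc1 hc2
  have hne : 2 ^ c ≠ p := by
    rintro rfl
    exact hp2 (((Nat.prime_dvd_prime_iff_eq Nat.prime_two hp).1
      (hp.eq_one_or_self_of_dvd 2 (dvd_pow_self 2 (by rintro rfl; exact hp.ne_one rfl)) |>.elim
        (by omega) (fun h => h ▸ dvd_rfl))).symm)
  by_cases hle : 2 * p ≤ 3 * 2 ^ c
  · obtain ⟨N, hN⟩ := exists_two_pow_mul_mem (u := 2 ^ c) (v := p) (by positivity)
      (lt_of_le_of_ne hc1 hne) hle
    refine ⟨N, fun n hn => ?_⟩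
    obtain ⟨a, i, j, h0, h1, h2⟩ := hN n hn
    have e : 2 ^ a * ((2 ^ c) ^ i * p ^ j) = 2 ^ (a + c * i) * p ^ j := by
      rw [pow_add, pow_mul]; ring
    rw [e] at h1 h2
    exact ⟨a + c * i, j, by omega, h1, h2⟩
  · obtain ⟨N, hN⟩ := exists_two_pow_mul_mem (u := p) (v := 2 ^ (c + 1)) hp.pos hc2
      (by rw [pow_succ]; omega)
    refine ⟨N, fun n hn => ?_⟩
    obtain ⟨a, i, j, h0, h1, h2⟩ := hN n hn
    have e : 2 ^ a * (p ^ i * (2 ^ (c + 1)) ^ j) = 2 ^ (a + (c + 1) * j) * p ^ i := by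
      rw [← pow_mul, pow_add 2 a]; ring
    rw [e] at h1 h2
    exact ⟨a + (c + 1) * j, i, by omega, h1, h2⟩

theorem two_pow_mul_pow_mem_setB {k p a j : ℕ} (hp : p.Prime) (hpk : p ∣ k * (k + 1)) (ha : 0 < a)
    (h9 : (k ≡ 2 [MOD 9] ∨ k ≡ 6 [MOD 9]) → p = 3 → j ≤ 1) : 2 ^ a * p ^ j ∈ setB k := by
  refine ⟨by have := hp.pos; positivity, (even_two.pow_of_ne_zero ha.ne').mul_right _, ?_, ?_⟩
  · intro q hq hqd
    rcases hq.dvd_mul.1 hqd with h | h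
    · rw [(Nat.prime_dvd_prime_iff_eq hq Nat.prime_two).1 (hq.dvd_of_dvd_pow h)]
      exact prime_two_dvd_mul_succ k
    · rwa [(Nat.prime_dvd_prime_iff_eq hq hp).1 (hq.dvd_of_dvd_pow h)]
  · intro hk h
    have h' : 3 ^ 2 ∣ p ^ j :=
      (Nat.Coprime.pow 2 a (by norm_num : Nat.Coprime 3 2)).dvd_of_dvd_mul_left h
    have h3 : p = 3 := ((Nat.prime_dvd_prime_iff_eq Nat.prime_three hp).1
      (Nat.prime_three.dvd_of_dvd_pow ((dvd_pow_self 3 two_ne_zero).trans h'))).symm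
    have := h9 hk h3
    rw [h3, Nat.pow_dvd_pow_iff_le_right (by norm_num)] at h'
    omega

/-- Otherwise 3 is the only possible odd prime, and it occurs only when k ≡ 2 or 6 mod 9. The odd
member of {k, k + 1} is then 1 or 3, since 9 cannot divide it; this is impossible for k > 2. -/
theorem exists_odd_prime_dvd {k : ℕ} (hk : 2 < k) : ∃ p : ℕ, p.Prime ∧ p ≠ 2 ∧ p ∣ k * (k + 1) ∧
    ((k ≡ 2 [MOD 9] ∨ k ≡ 6 [MOD 9]) → p ≠ 3) := by
  by_contra hcon
  push Not at hcon
  have hone : ∀ n : ℕ, ¬ 2 ∣ n → ¬ 3 ∣ n → n ∣ k * (k + 1) → n = 1 := by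
    intro n h2 h3 hd
    by_contra hne
    obtain ⟨p, hp, hpn⟩ := Nat.exists_prime_and_dvd hne
    have := hcon p hp (fun e => h2 (e ▸ hpn)) (hpn.trans hd)
    exact h3 (this.2 ▸ hpn)
  have h3 : 3 ∣ k * (k + 1) → k ≡ 2 [MOD 9] ∨ k ≡ 6 [MOD 9] := fun h =>
    (hcon 3 Nat.prime_three (by norm_num) h).1
  simp only [Nat.ModEq] at h3
  obtain ⟨n, hn, h2n, hk'⟩ : ∃ n, n ∣ k * (k + 1) ∧ ¬ 2 ∣ n ∧ (n = k ∨ n = k + 1) := by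
    by_cases h : 2 ∣ k
    · exact ⟨k + 1, dvd_mul_left _ _, by omega, Or.inr rfl⟩
    · exact ⟨k, dvd_mul_right _ _, h, Or.inl rfl⟩
  by_cases h3n : 3 ∣ n
  · have h9 := h3 (h3n.trans hn)
    obtain ⟨c, rfl⟩ := h3n
    have := hone c (by omega) (by omega) ((dvd_mul_left _ _).trans hn)
    omega
  · have := hone n h2n h3n hn
    omega

theorem exists_mem_two {n : ℕ} (hn : 1 ≤ n) :
    ∃ m ∈ setA 2 ∪ setB 2, n ≤ m ∧ 2 * m < 3 * n := by
  rcases Nat.lt_or_ge n 3 with h | h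
  · interval_cases n
    · exact ⟨1, Or.inl ⟨by norm_num, odd_one,
        fun p hp h => absurd (Nat.dvd_one.1 h) hp.ne_one, by norm_num⟩, by norm_num, by norm_num⟩
    · exact ⟨2 ^ 1 * 3 ^ 0, Or.inr (two_pow_mul_pow_mem_setB Nat.prime_three (by norm_num)
        (by norm_num) (by norm_num)), by norm_num, by norm_num⟩
  -- Using n − 1 gives 2^a < n ≤ 2^{a+1}; the strict lower bound makes 3·2^{a−1} < 3n/2.
  have h1 : 2 ^ Nat.log 2 (n - 1) ≤ n - 1 := Nat.pow_log_le_self 2 (by omega)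
  have h2 : n - 1 < 2 ^ (Nat.log 2 (n - 1) + 1) := Nat.lt_pow_succ_log_self (by norm_num) _
  have h0 : 0 < Nat.log 2 (n - 1) := Nat.log_pos (by norm_num) (by omega)
  generalize Nat.log 2 (n - 1) = a at h0 h1 h2
  obtain ⟨c, rfl⟩ : ∃ c, a = c + 1 := ⟨a - 1, by omega⟩
  rw [pow_succ, pow_succ] at h2
  rw [pow_succ] at h1
  by_cases hc : 0 < c ∧ n ≤ 3 * 2 ^ c
  · exact ⟨2 ^ c * 3 ^ 1, Or.inr (two_pow_mul_pow_mem_setB Nat.prime_three (by norm_num)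
      hc.1 (fun _ _ => le_rfl)), by omega, by omega⟩
  -- For c = 0 the candidate 3 is unavailable, being odd and not dividing k = 2; 4 suffices for n =
  -- 3, 4.
  · refine ⟨2 ^ (c + 2) * 3 ^ 0, Or.inr (two_pow_mul_pow_mem_setB Nat.prime_three (by norm_num)
      (by omega) (fun _ _ => by omega)), ?_, ?_⟩
    · rw [pow_succ, pow_succ]; omega
    · rw [pow_succ, pow_succ]
      rcases Nat.eq_zero_or_pos c with rfl | hc0
      · omega
      · omega

theorem exists_mem_of_two_lt {k : ℕ} (hk : 2 < k) :
    ∃ N, ∀ n, N ≤ n → ∃ m ∈ setA k ∪ setB k, n ≤ m ∧ 2 * m < 3 * n := by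
  obtain ⟨p, hp, hp2, hpk, hp3⟩ := exists_odd_prime_dvd hk
  obtain ⟨N, hN⟩ := exists_two_pow_mul_pow_mem hp hp2
  refine ⟨N, fun n hn => ?_⟩
  obtain ⟨a, j, h0, h1, h2⟩ := hN n hn
  exact ⟨_, Or.inr (two_pow_mul_pow_mem_setB hp hpk h0 fun h e => absurd e (hp3 h)), h1, h2⟩

theorem discriminatorValues_two : discriminatorValues (lucasU 2) = setA 2 ∪ setB 2 := by
  refine Set.Subset.antisymm ?_ (subset_discriminatorValues (by norm_num))
  rintro m ⟨n, hn, rfl⟩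
  exact discriminator_mem_of_exists (by norm_num) (exists_mem_two hn)

theorem mainTheorem4 :
    (∀ k : ℕ, 1 < k → ∃ F : Set ℕ, F.Finite ∧
      discriminatorValues (lucasU k) = setA k ∪ setB k ∪ F) ∧
    discriminatorValues (lucasU 2) = setA 2 ∪ setB 2 := by
  refine ⟨fun k hk => ?_, discriminatorValues_two⟩
  rcases Nat.eq_or_lt_of_le hk with rfl | hk2
  · exact ⟨∅, Set.finite_empty, by rw [Set.union_empty]; exact discriminatorValues_two⟩
  obtain ⟨N, hN⟩ := exists_mem_of_two_lt hk2
  refine ⟨discriminatorValues (lucasU k) \ (setA k ∪ setB k), ?_, ?_⟩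
  -- Exceptional values can only be D(n) with n < N.
  · refine ((Set.finite_Iio N).image (discriminator (lucasU k))).subset ?_
    rintro m ⟨⟨n, -, rfl⟩, hm⟩
    refine ⟨n, ?_, rfl⟩
    by_contra hn
    exact hm (discriminator_mem_of_exists hk.le (hN n (not_lt.1 hn)))
  · exact (Set.union_sdiff_cancel (subset_discriminatorValues hk.le)).symm
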